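/- **Setting.** Let $X,Y$ be geodesic metric spaces with base points $x_0\in X$, $y_0\in Y$, in which all geodesic triangles are $\delta$-thin (each side lies in the $\delta$-neighbourhood of the union of the two others), $\delta\ge 0$. Assume that for some $D$ every $x\in X$ satisfies $d(x,\gamma)<D$ for some geodesic ray $\gamma$ issuing from $x_0$, and likewise every point of $Y$ is at distance less than $D$ from a geodesic ray issuing from $y_0$. Let $\partial X,\partial Y$ be the ideal (Gromov) boundaries, i.e. the spaces of equivalence classes of sequences converging to infinity, with the topology for which $U$ is open iff for each $\xi\in U$ all $\eta$ with $(\xi|\eta)$ large enough belong to $U$. Here $(\xi|\eta)=\sup\liminf_{i,j\to\infty}(x_i|y_j)$ is the Gromov product with respect to the base point (supremum over sequences $x_i\to\xi$, $y_j\to\eta$). Put $d_{x_0}(\xi_1,\xi_2)=e^{-(\xi_1|\xi_2)}$ (the visual distance), and similarly $d_{y_0}$ on $\partial Y$. Let $\theta:\partial X\to\partial Y$ be a homeomorphism, and for $R>0$ let $$K(R)=\sup\left\{\left|\log\frac{d_{y_0}(\theta(\xi_1),\theta(\xi_2))}{d_{x_0}(\xi_1,\xi_2)}\right| \;:\; d_{x_0}(\xi_1,\xi_2)\ge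 e^{-R}\ \text{ or }\ d_{y_0}(\theta(\xi_1),\theta(\xi_2))\ge e^{-R}\right\}\in[0,\infty].$$ A *radial extension* of $\theta$ is a map $\Theta:X\to Y$ such that for every $x\in X$ there are a geodesic ray $\gamma$ from $x_0$ with $d(x,\gamma)<D$ and a geodesic ray $\gamma'$ from $y_0$ with $\gamma'(\infty)=\theta(\gamma(\infty))$ and $\Theta(x)=\gamma'(d(x_0,x))$. A map $f:E\to F$ of metric spaces is a $(\lambda,C)$-*quasi-isometry* if there is $g:F\to E$ with $d(f(x),f(x'))\le\lambda d(x,x')+C$, $d(g(y),g(y'))\le\lambda d(y,y')+C$, $d(g(f(x)),x)\le C$ and $d(f(g(y)),y)\le C$ for all $x,x'\in E$, $y,y'\in F$; it is a $(\lambda,C)$-*quasi-isometric embedding* if $\frac1\lambda(d(x,x')-C)\le d(f(x),f(x'))\le\lambda d(x,x')+C$ for all $x,x'\in E$. **Theorem.** There is a universal constant $A>0$ such that, for all data as above and with $c=A(D+\delta)$, the following holds. 1. If every point of $\partial Y$ is the endpoint of a geodesic ray from $y_0$, then $\theta$ has a radial extension. 2. For every radial extension $\Theta$ of $\theta$ and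 every $R>0$ with $K(R)<\infty$, the map $\Theta$ sends the closed ball $B(x_0,R)$ into the closed ball $B(y_0,R)$, and the restriction $\Theta:B(x_0,R)\to B(y_0,R)$ is a $$\left(1+\frac{2K(R)}{c},\ 2K(R)+c\right)\text{-quasi-isometry}$$ and also a quasi-isometric embedding with the same two constants. -/

import Mathlib

open Filter Topology

noncomputable section

namespace RadialQI

/-- `γ`, restricted to `[0, dist a b]`, is a geodesic segment from `a` to `b`. -/
def IsGeodesicSegment {X : Type*} [MetricSpace X] (γ : ℝ → X) (a b : X) : Prop :=
  γ 0 = a ∧ γ (dist a b) = b ∧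
    ∀ s ∈ Set.Icc 0 (dist a b), ∀ t ∈ Set.Icc 0 (dist a b), dist (γ s) (γ t) = |s - t|

/-- Any two points are joined by a geodesic segment. -/
def IsGeodesicSpace (X : Type*) [MetricSpace X] : Prop :=
  ∀ a b : X, ∃ γ : ℝ → X, IsGeodesicSegment γ a b

/-- All geodesic triangles are `δ`-thin: each side lies in the closed `δ`-neighbourhood of the
union of the two other sides. -/
def IsDeltaHyperbolic (X : Type*) [MetricSpace X] (δ : ℝ) : Prop :=
  ∀ (a b c : X) (α β γ : ℝ → X),
    IsGeodesicSegment α a b → IsGeodesicSegment β b c → IsGeodesicSegment γ a c →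
    ∀ t ∈ Set.Icc 0 (dist a b),
      (∃ s ∈ Set.Icc 0 (dist b c), dist (α t) (β s) ≤ δ) ∨
      (∃ s ∈ Set.Icc 0 (dist a c), dist (α t) (γ s) ≤ δ)

/-- The Gromov product `(x|y)` with respect to the base point `x₀`. -/
def gromovProduct {X : Type*} [MetricSpace X] (x₀ x y : X) : ℝ :=
  (dist x₀ x + dist x₀ y - dist x y) / 2

/-- Sequences converging to infinity: `(x_i|x_j) → ∞` as `i, j → ∞`. -/
def GromovSequence {X : Type*} [MetricSpace X] (x₀ : X) : Type _ :=
  {x : ℕ → X // Tendsto (fun p : ℕ × ℕ => gromovProduct x₀ (x p.1) (x p.2)) atTop atTop}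

/-- The ideal boundary: sequences converging to infinity, where `x` and `y` are identified if
`(x_i|y_j) → ∞` as `i, j → ∞`. In a hyperbolic space this relation is an equivalence relation.
Neither it nor the sequences depend on the base point, since changing the base point
changes the Gromov product by a bounded amount. -/
def Boundary {X : Type*} [MetricSpace X] (x₀ : X) : Type _ :=
  Quot (fun x y : GromovSequence x₀ =>
    Tendsto (fun p : ℕ × ℕ => gromovProduct x₀ (x.1 p.1) (y.1 p.2)) atTop atTop)

/-- The ideal point to which a sequence converges. -/
def Boundary.mk {X : Type*} [MetricSpace X] {x₀ : X} (x : GromovSequence x₀) : Boundary x₀ :=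
  Quot.mk _ x

/-- The Gromov product of two ideal points: the supremum of
`liminf (x_i|y_j)` as `i, j → ∞`, over all sequences `x → ξ` and `y → η`. -/
def boundaryProduct {X : Type*} [MetricSpace X] {x₀ : X} (ξ η : Boundary x₀) : EReal :=
  ⨆ (x : GromovSequence x₀) (y : GromovSequence x₀)
    (_ : Boundary.mk x = ξ) (_ : Boundary.mk y = η),
    liminf (fun p : ℕ × ℕ => ((gromovProduct x₀ (x.1 p.1) (y.1 p.2) : ℝ) : EReal)) atTop

/-- The visual distance `exp (-(ξ|η))` of two ideal points, seen from `x₀`. -/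
def visDist {X : Type*} [MetricSpace X] {x₀ : X} (ξ η : Boundary x₀) : ℝ :=
  (EReal.exp (-boundaryProduct ξ η)).toReal

/-- The topology of the ideal boundary: `U` is open if it contains, with each of its points `ξ`,
all `η` for which `(ξ|η)` is large enough. -/
instance {X : Type*} [MetricSpace X] {x₀ : X} : TopologicalSpace (Boundary x₀) where
  IsOpen U := ∀ ξ ∈ U, ∃ r : ℝ, ∀ η : Boundary x₀, (r : EReal) < boundaryProduct ξ η → η ∈ U
  isOpen_univ := fun _ _ => ⟨0, fun _ _ => trivial⟩
  isOpen_inter := by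
    intro U V hU hV ξ hξ
    obtain ⟨r, hr⟩ := hU ξ hξ.1
    obtain ⟨s, hs⟩ := hV ξ hξ.2
    refine ⟨max r s, fun η hη => ⟨hr η (lt_of_le_of_lt ?_ hη), hs η (lt_of_le_of_lt ?_ hη)⟩⟩
    · exact EReal.coe_le_coe_iff.2 (le_max_left r s)
    · exact EReal.coe_le_coe_iff.2 (le_max_right r s)
  isOpen_sUnion := by
    intro S hS ξ hξ
    obtain ⟨U, hU, hξU⟩ := hξ
    obtain ⟨r, hr⟩ := hS U hU ξ hξU
    exact ⟨r, fun η hη => ⟨U, hU, hr η hη⟩⟩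

/-- A geodesic ray issuing from `x₀`; only the values at `t ≥ 0` matter. -/
structure GeodesicRay {X : Type*} [MetricSpace X] (x₀ : X) where
  toFun : ℝ → X
  map_zero : toFun 0 = x₀
  isometry : ∀ s t : ℝ, 0 ≤ s → 0 ≤ t → dist (toFun s) (toFun t) = |s - t|

theorem GeodesicRay.gromovProduct_eq {X : Type*} [MetricSpace X] {x₀ : X} (γ : GeodesicRay x₀)
    {s t : ℝ} (hs : 0 ≤ s) (ht : 0 ≤ t) :
    gromovProduct x₀ (γ.toFun s) (γ.toFun t) = min s t := by
  have h : ∀ u : ℝ, 0 ≤ u → dist x₀ (γ.toFun u) = u := fun u hu => by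
    have h0 := γ.isometry 0 u le_rfl hu
    rwa [γ.map_zero, zero_sub, abs_neg, abs_of_nonneg hu] at h0
  rw [gromovProduct, h s hs, h t ht, γ.isometry s t hs ht]
  rcases le_total s t with hst | hst
  · rw [min_eq_left hst, abs_of_nonpos (sub_nonpos.2 hst)]
    ring
  · rw [min_eq_right hst, abs_of_nonneg (sub_nonneg.2 hst)]
    ring

/-- The sequence `γ(0), γ(1), γ(2), …`. -/
def GeodesicRay.sequence {X : Type*} [MetricSpace X] {x₀ : X} (γ : GeodesicRay x₀) :
    GromovSequence x₀ :=
  ⟨fun n => γ.toFun n, by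
    rw [tendsto_atTop]
    intro b
    obtain ⟨N, hN⟩ := exists_nat_ge b
    filter_upwards [eventually_ge_atTop ((N, N) : ℕ × ℕ)] with p hp
    rw [γ.gromovProduct_eq (Nat.cast_nonneg _) (Nat.cast_nonneg _)]
    exact le_min (hN.trans (Nat.cast_le.2 hp.1)) (hN.trans (Nat.cast_le.2 hp.2))⟩

/-- The endpoint `γ(∞)` of a geodesic ray. -/
def GeodesicRay.endpoint {X : Type*} [MetricSpace X] {x₀ : X} (γ : GeodesicRay x₀) :
    Boundary x₀ :=
  Boundary.mk γ.sequence

/-- `d(x, γ) < D`. -/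
def GeodesicRay.PassesNear {X : Type*} [MetricSpace X] {x₀ : X} (γ : GeodesicRay x₀)
    (D : ℝ) (x : X) : Prop :=
  ∃ t : ℝ, 0 ≤ t ∧ dist x (γ.toFun t) < D

/-- Every point of the space lies within `D` of a geodesic ray from the base point. -/
def RaysNearEveryPoint {X : Type*} [MetricSpace X] (x₀ : X) (D : ℝ) : Prop :=
  ∀ x : X, ∃ γ : GeodesicRay x₀, γ.PassesNear D x

/-- `Θ` is a radial extension of the boundary map `θ`: for each `x` one chooses a ray `γ` from
`x₀` with `d(x, γ) < D` and a ray `γ'` from `y₀` with `γ'(∞) = θ(γ(∞))`, and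
`Θ(x) = γ'(d(x₀, x))`. -/
def IsRadialExtension {X Y : Type*} [MetricSpace X] [MetricSpace Y] {x₀ : X} {y₀ : Y}
    (D : ℝ) (θ : Boundary x₀ → Boundary y₀) (Θ : X → Y) : Prop :=
  ∀ x : X, ∃ (γ : GeodesicRay x₀) (γ' : GeodesicRay y₀),
    γ.PassesNear D x ∧ γ'.endpoint = θ γ.endpoint ∧ Θ x = γ'.toFun (dist x₀ x)

/-- The function `K(R)`, with values in `[0, ∞]`. -/
def distortion {X Y : Type*} [MetricSpace X] [MetricSpace Y] {x₀ : X} {y₀ : Y}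
    (θ : Boundary x₀ → Boundary y₀) (R : ℝ) : ENNReal :=
  ⨆ (ξ₁ : Boundary x₀) (ξ₂ : Boundary x₀)
    (_ : Real.exp (-R) ≤ visDist ξ₁ ξ₂ ∨ Real.exp (-R) ≤ visDist (θ ξ₁) (θ ξ₂)),
    ENNReal.ofReal |Real.log (visDist (θ ξ₁) (θ ξ₂) / visDist ξ₁ ξ₂)|

/-- `f` is a `(lam, C)`-quasi-isometry: together with some `g : F → E` it satisfies
the coarse Lipschitz inequalities, and `f` and `g` are inverse to each other up to `C`. -/
def IsQuasiIsometry {E F : Type*} [MetricSpace E] [MetricSpace F] (lam C : ℝ) (f : E → F) :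
    Prop :=
  ∃ g : F → E,
    (∀ x x' : E, dist (f x) (f x') ≤ lam * dist x x' + C) ∧
    (∀ y y' : F, dist (g y) (g y') ≤ lam * dist y y' + C) ∧
    (∀ x : E, dist (g (f x)) x ≤ C) ∧
    (∀ y : F, dist (f (g y)) y ≤ C)

/-- `f` is a `(lam, C)`-quasi-isometric embedding. -/
def IsQuasiIsometricEmbedding {E F : Type*} [MetricSpace E] [MetricSpace F] (lam C : ℝ)
    (f : E → F) : Prop :=
  ∀ x x' : E, 1 / lam * (dist x x' - C) ≤ dist (f x) (f x') ∧
    dist (f x) (f x') ≤ lam * dist x x' + C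

end RadialQI

end

/-! In a hyperbolic space, up to a multiple of `δ`, two rays from the base point fellow-travel up to
the height given by the Gromov product of their endpoints and then separate. Hence the distance
between points at heights `r` and `s` is `r + s - 2 min(r, s, (ξ|η))` up to an error, and below
height `R` only the product truncated at `R` matters. By definition of `K(R)`, `θ` moves this
truncated product by at most `K(R)`: either one of the two products is at most `R`, and they differ
by at most `K(R)`, or both exceed `R` and truncation hides the difference. Since `Θ` preserves
heights, it changes distances in the ball by at most `2K(R)` plus a multiple of `D + δ`. The
estimate is purely additive; the factor `1 + 2K(R)/c` is only a weakening.

The carrying lemmas are `IsDeltaHyperbolic.fourPoint`, the two comparisons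
`FourPoint.gromovProduct_ray_le` and `FourPoint.le_gromovProduct_ray`, and
`le_boundaryProduct_up_to_distortion`. The inverse is built in
`IsRadialExtension.exists_coarse_inverse`: a preimage of a ray's endpoint need not be the endpoint
of a ray, so an approximating ray is used. -/

namespace RadialQI

/-! ### From thin triangles to the four-point inequality. -/

section ThinTriangles

variable {X : Type*} [MetricSpace X]

theorem gromovProduct_comm (w x y : X) : gromovProduct w x y = gromovProduct w y x := by
  rw [gromovProduct, gromovProduct, dist_comm x y, add_comm (dist w x)]

theorem gromovProduct_nonneg (w x y : X) : 0 ≤ gromovProduct w x y := by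
  have := dist_triangle x w y
  rw [dist_comm x w] at this
  rw [gromovProduct]
  linarith

theorem gromovProduct_le_dist_left (w x y : X) : gromovProduct w x y ≤ dist w x := by
  have := dist_triangle w x y
  rw [gromovProduct]
  linarith

theorem gromovProduct_le_dist_right (w x y : X) : gromovProduct w x y ≤ dist w y := by
  rw [gromovProduct_comm]
  exact gromovProduct_le_dist_left w y x

theorem gromovProduct_le_add_dist (w x x' y : X) :
    gromovProduct w x y ≤ gromovProduct w x' y + dist x x' := by
  have h1 := dist_triangle w x' x
  have h2 := dist_triangle x' x y
  rw [dist_comm x' x] at h1 h2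
  rw [gromovProduct, gromovProduct]
  linarith

namespace IsGeodesicSegment

variable {γ : ℝ → X} {a b : X}

theorem dist_left (h : IsGeodesicSegment γ a b) {t : ℝ} (ht : t ∈ Set.Icc 0 (dist a b)) :
    dist a (γ t) = t := by
  have := h.2.2 0 ⟨le_rfl, dist_nonneg⟩ t ht
  rwa [h.1, zero_sub, abs_neg, abs_of_nonneg ht.1] at this

theorem dist_right (h : IsGeodesicSegment γ a b) {t : ℝ} (ht : t ∈ Set.Icc 0 (dist a b)) :
    dist (γ t) b = dist a b - t := by
  have := h.2.2 t ht (dist a b) ⟨dist_nonneg, le_rfl⟩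
  rwa [h.2.1, abs_sub_comm, abs_of_nonneg (by linarith [ht.2])] at this

theorem continuousOn (h : IsGeodesicSegment γ a b) :
    ContinuousOn γ (Set.Icc 0 (dist a b)) := by
  refine LipschitzOnWith.continuousOn (K := 1) (LipschitzOnWith.of_dist_le_mul ?_)
  intro s hs t ht
  rw [h.2.2 s hs t ht, Real.dist_eq]
  simp

theorem gromovProduct_le_dist (h : IsGeodesicSegment γ a b) (w : X) {t : ℝ}
    (ht : t ∈ Set.Icc 0 (dist a b)) : gromovProduct w a b ≤ dist w (γ t) := by
  have h1 := dist_triangle w (γ t) a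
  have h2 := dist_triangle w (γ t) b
  rw [dist_comm (γ t) a, h.dist_left ht] at h1
  rw [h.dist_right ht] at h2
  rw [gromovProduct]
  linarith

end IsGeodesicSegment

/-- The points of one segment that are `δ`-close to another segment form a closed set. -/
theorem isClosed_near {α β : ℝ → X} {a b c d : X} (hα : IsGeodesicSegment α a b)
    (hβ : IsGeodesicSegment β c d) (δ : ℝ) :
    IsClosed {t | t ∈ Set.Icc 0 (dist a b) ∧
      ∃ s ∈ Set.Icc 0 (dist c d), dist (α t) (β s) ≤ δ} := by
  have hcpt : IsCompact (Set.Icc 0 (dist a b) ×ˢ Set.Icc 0 (dist c d)) :=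
    isCompact_Icc.prod isCompact_Icc
  have hcont : ContinuousOn (fun p : ℝ × ℝ => dist (α p.1) (β p.2))
      (Set.Icc 0 (dist a b) ×ˢ Set.Icc 0 (dist c d)) :=
    continuous_dist.comp_continuousOn
      ((hα.continuousOn.comp continuousOn_fst fun p hp => hp.1).prodMk
        (hβ.continuousOn.comp continuousOn_snd fun p hp => hp.2))
  have hc := hcont.preimage_isClosed_of_isClosed hcpt.isClosed (isClosed_Iic (a := δ))
  have := ((hcpt.of_isClosed_subset hc Set.inter_subset_left).image continuous_fst).isClosed
  convert this using 1
  ext t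
  constructor
  · rintro ⟨ht, s, hs, hd⟩
    exact ⟨(t, s), ⟨⟨ht, hs⟩, hd⟩, rfl⟩
  · rintro ⟨p, ⟨⟨h1, h2⟩, hd⟩, rfl⟩
    exact ⟨h1, p.2, h2, hd⟩

/-- In a thin triangle with vertex `w`, some point of the opposite side has distance to `w` at
most the Gromov product plus `2δ`. -/
theorem exists_dist_le_gromovProduct_add {δ : ℝ} (hδ : 0 ≤ δ) (hgeo : IsGeodesicSpace X)
    (hyp : IsDeltaHyperbolic X δ) (w x y : X) {α : ℝ → X} (hα : IsGeodesicSegment α x y) :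
    ∃ t ∈ Set.Icc 0 (dist x y), dist w (α t) ≤ gromovProduct w x y + 2 * δ := by
  obtain ⟨β, hβ⟩ := hgeo y w
  obtain ⟨γ, hγ⟩ := hgeo x w
  have hcover := hyp x y w α β γ hα hβ hγ
  -- The side is covered by two nonempty closed sets, the points near each of the other sides. By
  -- connectedness they meet, so one point is `δ`-close to both.
  have hconn : IsPreconnected (Set.Icc 0 (dist x y)) := isPreconnected_Icc
  rw [isPreconnected_closed_iff] at hconn
  obtain ⟨t, ht, ⟨-, s, hs, hsd⟩, ⟨-, u, hu, hud⟩⟩ := hconn _ _ (isClosed_near hα hβ δ)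
    (isClosed_near hα hγ δ)
    (fun t ht => (hcover t ht).imp (fun h => ⟨ht, h⟩) (fun h => ⟨ht, h⟩))
    ⟨dist x y, ⟨dist_nonneg, le_rfl⟩, ⟨dist_nonneg, le_rfl⟩, 0, ⟨le_rfl, dist_nonneg⟩, by
      rwa [hα.2.1, hβ.1, dist_self]⟩
    ⟨0, ⟨le_rfl, dist_nonneg⟩, ⟨le_rfl, dist_nonneg⟩, 0, ⟨le_rfl, dist_nonneg⟩, by
      rwa [hα.1, hγ.1, dist_self]⟩
  refine ⟨t, ht, ?_⟩
  have e1 := hα.dist_left ht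
  have e2 := hα.dist_right ht
  have e3 := hβ.dist_left hs
  have e4 := hβ.dist_right hs
  have e5 := hγ.dist_left hu
  have e6 := hγ.dist_right hu
  have t1 := dist_triangle (α t) (β s) y
  have t2 := dist_triangle (α t) (β s) w
  have t3 := dist_triangle (α t) (γ u) x
  have t4 := dist_triangle (α t) (γ u) w
  rw [dist_comm (β s) y] at t1
  rw [dist_comm (α t) x, dist_comm (γ u) x] at t3
  rw [gromovProduct, dist_comm w x, dist_comm w y, dist_comm w (α t)]
  linarith

/-- Gromov's four-point inequality, with base point `w`. -/
def FourPoint (w : X) (h : ℝ) : Prop :=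
  ∀ x y z : X, min (gromovProduct w x y) (gromovProduct w y z) - h ≤ gromovProduct w x z

/-- The point of `[x, z]` within `(x|z) + 2δ` of `w` is `δ`-close to `[x, y]` or `[y, z]`, and no
point of these sides is closer to `w` than the corresponding product. -/
theorem IsDeltaHyperbolic.fourPoint {δ : ℝ} (hyp : IsDeltaHyperbolic X δ) (hδ : 0 ≤ δ)
    (hgeo : IsGeodesicSpace X) (w : X) : FourPoint w (3 * δ) := by
  intro x y z
  obtain ⟨α, hα⟩ := hgeo x z
  obtain ⟨β, hβ⟩ := hgeo z y
  obtain ⟨γ, hγ⟩ := hgeo x y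
  obtain ⟨t, ht, htd⟩ := exists_dist_le_gromovProduct_add hδ hgeo hyp w x z hα
  rcases hyp x z y α β γ hα hβ hγ t ht with ⟨s, hs, hd⟩ | ⟨s, hs, hd⟩
  · have h1 := hβ.gromovProduct_le_dist w hs
    have h2 := dist_triangle w (α t) (β s)
    rw [gromovProduct_comm] at h1
    linarith [min_le_right (gromovProduct w x y) (gromovProduct w y z)]
  · have h1 := hγ.gromovProduct_le_dist w hs
    have h2 := dist_triangle w (α t) (γ s)
    linarith [min_le_left (gromovProduct w x y) (gromovProduct w y z)]

theorem FourPoint.le {w : X} {h : ℝ} (H : FourPoint w h) {t : ℝ} {x y z : X}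
    (h1 : t ≤ gromovProduct w x y) (h2 : t ≤ gromovProduct w y z) :
    t - h ≤ gromovProduct w x z :=
  (sub_le_sub_right (le_min h1 h2) h).trans (H x y z)

theorem FourPoint.nonneg {w : X} {h : ℝ} (H : FourPoint w h) : 0 ≤ h := by
  have := H w w w
  simpa [gromovProduct] using this

theorem FourPoint.le_chain {w : X} {h : ℝ} (H : FourPoint w h) {t : ℝ} {x y z u : X}
    (h1 : t ≤ gromovProduct w x y) (h2 : t ≤ gromovProduct w y z)
    (h3 : t ≤ gromovProduct w z u) : t - 2 * h ≤ gromovProduct w x u := by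
  have := H.le (H.le h1 h2) (by linarith [H.nonneg] : t - h ≤ gromovProduct w z u)
  linarith

end ThinTriangles

/-! ### Gromov products of ideal points. -/

section BoundaryProducts

variable {X : Type*} [MetricSpace X] {x₀ : X} {h : ℝ}

theorem eventually_atTop_nat_prod {p : ℕ → ℕ → Prop} :
    (∀ᶠ q : ℕ × ℕ in atTop, p q.1 q.2) ↔ ∃ N, ∀ i ≥ N, ∀ j ≥ N, p i j := by
  rw [eventually_atTop]
  constructor
  · rintro ⟨a, ha⟩
    exact ⟨max a.1 a.2, fun i hi j hj =>
      ha (i, j) ⟨(le_max_left _ _).trans hi, (le_max_right _ _).trans hj⟩⟩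
  · rintro ⟨N, hN⟩
    exact ⟨(N, N), fun b hb => hN _ hb.1 _ hb.2⟩

theorem tendsto_nat_prod_atTop_iff {f : ℕ → ℕ → ℝ} :
    Tendsto (fun q : ℕ × ℕ => f q.1 q.2) atTop atTop ↔
      ∀ t, ∃ N, ∀ i ≥ N, ∀ j ≥ N, t ≤ f i j := by
  rw [tendsto_atTop]
  exact forall_congr' fun t => eventually_atTop_nat_prod (p := fun i j => t ≤ f i j)

theorem GromovSequence.exists_le (x : GromovSequence x₀) (t : ℝ) :
    ∃ N, ∀ i ≥ N, ∀ j ≥ N, t ≤ gromovProduct x₀ (x.1 i) (x.1 j) :=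
  (tendsto_nat_prod_atTop_iff (f := fun i j => gromovProduct x₀ (x.1 i) (x.1 j))).1 x.2 t

/-- `Quot` identifies along the generated equivalence; the four-point inequality makes the relation
transitive, so nothing is added. -/
theorem FourPoint.boundary_mk_eq_iff (H : FourPoint x₀ h) (x y : GromovSequence x₀) :
    Boundary.mk x = Boundary.mk y ↔
      ∀ t, ∃ N, ∀ i ≥ N, ∀ j ≥ N, t ≤ gromovProduct x₀ (x.1 i) (y.1 j) := by
  have key : Equivalence (fun x y : GromovSequence x₀ =>
      Tendsto (fun p : ℕ × ℕ => gromovProduct x₀ (x.1 p.1) (y.1 p.2)) atTop atTop) := by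
    refine ⟨fun x => x.2, fun {x y} hxy => ?_, fun {x y z} hxy hyz => ?_⟩
    · rw [tendsto_nat_prod_atTop_iff (f := fun i j => gromovProduct x₀ (x.1 i) (y.1 j))] at hxy
      rw [tendsto_nat_prod_atTop_iff (f := fun i j => gromovProduct x₀ (y.1 i) (x.1 j))]
      intro t
      obtain ⟨N, hN⟩ := hxy t
      exact ⟨N, fun i hi j hj => gromovProduct_comm x₀ (x.1 j) (y.1 i) ▸ hN j hj i hi⟩
    · rw [tendsto_nat_prod_atTop_iff (f := fun i j => gromovProduct x₀ (x.1 i) (y.1 j))] at hxy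
      rw [tendsto_nat_prod_atTop_iff (f := fun i j => gromovProduct x₀ (y.1 i) (z.1 j))] at hyz
      rw [tendsto_nat_prod_atTop_iff (f := fun i j => gromovProduct x₀ (x.1 i) (z.1 j))]
      intro t
      obtain ⟨N, hN⟩ := hxy (t + h)
      obtain ⟨M, hM⟩ := hyz (t + h)
      refine ⟨max N M, fun i hi j hj => ?_⟩
      have := H.le (hN i ((le_max_left _ _).trans hi) (max N M) (le_max_left _ _))
        (hM (max N M) (le_max_right _ _) j ((le_max_right _ _).trans hj))
      linarith
  rw [← tendsto_nat_prod_atTop_iff (f := fun i j => gromovProduct x₀ (x.1 i) (y.1 j)),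
    ← key.eqvGen_iff]
  exact Quot.eq

theorem Boundary.exists_mk (ξ : Boundary x₀) : ∃ x : GromovSequence x₀, Boundary.mk x = ξ :=
  Quot.exists_rep ξ

theorem le_boundaryProduct {t : ℝ} {x y : GromovSequence x₀}
    (hxy : ∃ N, ∀ i ≥ N, ∀ j ≥ N, t ≤ gromovProduct x₀ (x.1 i) (y.1 j)) :
    (t : EReal) ≤ boundaryProduct (Boundary.mk x) (Boundary.mk y) := by
  refine le_trans ?_ (le_iSup_of_le x (le_iSup_of_le y (le_iSup_of_le rfl
    (le_iSup_of_le rfl le_rfl))))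
  refine le_liminf_of_le (by isBoundedDefault) ?_
  rw [← eventually_atTop_nat_prod (p := fun i j => t ≤ gromovProduct x₀ (x.1 i) (y.1 j))] at hxy
  exact hxy.mono fun q hq => EReal.coe_le_coe_iff.2 hq

theorem exists_of_lt_boundaryProduct {t : ℝ} {ξ η : Boundary x₀}
    (ht : (t : EReal) < boundaryProduct ξ η) :
    ∃ x y : GromovSequence x₀, Boundary.mk x = ξ ∧ Boundary.mk y = η ∧
      ∃ N, ∀ i ≥ N, ∀ j ≥ N, t ≤ gromovProduct x₀ (x.1 i) (y.1 j) := by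
  simp only [boundaryProduct, lt_iSup_iff] at ht
  obtain ⟨x, y, hx, hy, hlt⟩ := ht
  refine ⟨x, y, hx, hy, ?_⟩
  rw [← eventually_atTop_nat_prod (p := fun i j => t ≤ gromovProduct x₀ (x.1 i) (y.1 j))]
  exact (eventually_lt_of_lt_liminf hlt).mono fun q hq => (EReal.coe_lt_coe_iff.1 hq).le

/-- Up to `2h`, the boundary product is a lower bound for the products along arbitrary
representatives. -/
theorem FourPoint.exists_le_of_lt_boundaryProduct (H : FourPoint x₀ h) {t : ℝ}
    {x y : GromovSequence x₀}
    (ht : (t : EReal) < boundaryProduct (Boundary.mk x) (Boundary.mk y)) :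
    ∃ N, ∀ i ≥ N, ∀ j ≥ N, t - 2 * h ≤ gromovProduct x₀ (x.1 i) (y.1 j) := by
  obtain ⟨x', y', hx, hy, N, hN⟩ := exists_of_lt_boundaryProduct ht
  obtain ⟨M, hM⟩ := (H.boundary_mk_eq_iff x x').1 hx.symm t
  obtain ⟨L, hL⟩ := (H.boundary_mk_eq_iff y' y).1 hy t
  refine ⟨max N (max M L), fun i hi j hj => ?_⟩
  simp only [ge_iff_le, max_le_iff] at hi hj
  set k := max N (max M L)
  have hk : N ≤ k ∧ M ≤ k ∧ L ≤ k := by simp [k]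
  exact H.le_chain (hM i hi.2.1 k hk.2.1) (hN k hk.1 k hk.1) (hL k hk.2.2 j hj.2.2)

theorem boundaryProduct_comm (ξ η : Boundary x₀) :
    boundaryProduct ξ η = boundaryProduct η ξ := by
  have key : ∀ ξ η : Boundary x₀, boundaryProduct ξ η ≤ boundaryProduct η ξ := by
    intro ξ η
    refine EReal.ge_of_forall_gt_iff_ge.1 fun t ht => ?_
    obtain ⟨x, y, rfl, rfl, N, hN⟩ := exists_of_lt_boundaryProduct ht
    exact le_boundaryProduct ⟨N, fun i hi j hj =>
      gromovProduct_comm x₀ (x.1 j) (y.1 i) ▸ hN j hj i hi⟩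
  exact le_antisymm (key ξ η) (key η ξ)

theorem boundaryProduct_nonneg (ξ η : Boundary x₀) : 0 ≤ boundaryProduct ξ η := by
  obtain ⟨x, rfl⟩ := ξ.exists_mk
  obtain ⟨y, rfl⟩ := η.exists_mk
  exact le_boundaryProduct ⟨0, fun i _ j _ => gromovProduct_nonneg _ _ _⟩

theorem boundaryProduct_self (ξ : Boundary x₀) : boundaryProduct ξ ξ = ⊤ := by
  obtain ⟨x, rfl⟩ := ξ.exists_mk
  exact EReal.eq_top_iff_forall_lt _ |>.2 fun t =>
    (EReal.coe_lt_coe_iff.2 (lt_add_one t)).trans_le (le_boundaryProduct (x.exists_le (t + 1)))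

theorem FourPoint.eq_of_boundaryProduct_eq_top (H : FourPoint x₀ h) {ξ η : Boundary x₀}
    (htop : boundaryProduct ξ η = ⊤) : ξ = η := by
  obtain ⟨x, rfl⟩ := ξ.exists_mk
  obtain ⟨y, rfl⟩ := η.exists_mk
  rw [H.boundary_mk_eq_iff]
  intro t
  have := H.exists_le_of_lt_boundaryProduct (t := t + 2 * h) (htop ▸ EReal.coe_lt_top _)
  simpa using this

theorem le_of_forall_coe_lt {t : ℝ} {a : EReal} (hta : ∀ s : ℝ, s < t → (s : EReal) ≤ a) :
    (t : EReal) ≤ a :=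
  EReal.ge_of_forall_gt_iff_ge.1 fun s hs => hta s (EReal.coe_lt_coe_iff.1 hs)

theorem FourPoint.le_boundaryProduct_trans (H : FourPoint x₀ h) {t : ℝ} {ξ η ζ : Boundary x₀}
    (h1 : (t : EReal) ≤ boundaryProduct ξ η) (h2 : (t : EReal) ≤ boundaryProduct η ζ) :
    ((t - 3 * h : ℝ) : EReal) ≤ boundaryProduct ξ ζ := by
  obtain ⟨x, rfl⟩ := ξ.exists_mk
  obtain ⟨y, rfl⟩ := η.exists_mk
  obtain ⟨z, rfl⟩ := ζ.exists_mk
  refine le_of_forall_coe_lt fun s hs => le_boundaryProduct ?_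
  have hs' : ((s + 3 * h : ℝ) : EReal) < t := EReal.coe_lt_coe_iff.2 (by linarith)
  obtain ⟨N, hN⟩ := H.exists_le_of_lt_boundaryProduct (hs'.trans_le h1)
  obtain ⟨M, hM⟩ := H.exists_le_of_lt_boundaryProduct (hs'.trans_le h2)
  refine ⟨max N M, fun i hi j hj => ?_⟩
  have := H.le (hN i ((le_max_left _ _).trans hi) (max N M) (le_max_left _ _))
    (hM (max N M) (le_max_right _ _) j ((le_max_right _ _).trans hj))
  linarith

theorem visDist_eq_exp {ξ η : Boundary x₀} {a : ℝ} (ha : boundaryProduct ξ η = a) :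
    visDist ξ η = Real.exp (-a) := by
  rw [visDist, ha, ← EReal.coe_neg, EReal.exp_coe, ENNReal.toReal_ofReal (Real.exp_pos _).le]

end BoundaryProducts

/-! ### Products along rays against products of their endpoints. -/

section Rays

variable {X : Type*} [MetricSpace X] {x₀ : X} {h : ℝ}

theorem GeodesicRay.dist_base (γ : GeodesicRay x₀) {t : ℝ} (ht : 0 ≤ t) :
    dist x₀ (γ.toFun t) = t := by
  have h0 := γ.isometry 0 t le_rfl ht
  rwa [γ.map_zero, zero_sub, abs_neg, abs_of_nonneg ht] at h0

/-- The parameter of the nearby point differs from `dist x₀ x` by less than `D`, so correcting the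
height costs another `D`. -/
theorem GeodesicRay.PassesNear.dist_le {γ : GeodesicRay x₀} {D : ℝ} {x : X}
    (hx : γ.PassesNear D x) : dist x (γ.toFun (dist x₀ x)) ≤ 2 * D := by
  obtain ⟨t, ht, hd⟩ := hx
  have h1 := dist_triangle x (γ.toFun t) (γ.toFun (dist x₀ x))
  have h2 := abs_dist_sub_le (γ.toFun t) x x₀
  rw [dist_comm _ x₀, dist_comm x x₀, γ.dist_base ht, dist_comm (γ.toFun t) x] at h2
  rw [γ.isometry t _ ht dist_nonneg] at h1
  linarith

theorem FourPoint.gromovProduct_ray_le (H : FourPoint x₀ h) (α β : GeodesicRay x₀) {r s : ℝ}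
    (hr : 0 ≤ r) (hs : 0 ≤ s) :
    ((gromovProduct x₀ (α.toFun r) (β.toFun s) - 2 * h : ℝ) : EReal) ≤
      boundaryProduct α.endpoint β.endpoint := by
  obtain ⟨N, hN⟩ := exists_nat_ge (max r s)
  refine le_boundaryProduct ⟨N, fun i hi j hj => ?_⟩
  have hi' : max r s ≤ i := hN.trans (Nat.cast_le.2 hi)
  have hj' : max r s ≤ j := hN.trans (Nat.cast_le.2 hj)
  have h1 := gromovProduct_le_dist_left x₀ (α.toFun r) (β.toFun s)
  have h2 := gromovProduct_le_dist_right x₀ (α.toFun r) (β.toFun s)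
  rw [α.dist_base hr] at h1
  rw [β.dist_base hs] at h2
  refine H.le_chain (y := α.toFun r) (z := β.toFun s) ?_ le_rfl ?_
  · change _ ≤ gromovProduct x₀ (α.toFun i) (α.toFun r)
    rwa [α.gromovProduct_eq (Nat.cast_nonneg _) hr, min_eq_right ((le_max_left _ _).trans hi')]
  · change _ ≤ gromovProduct x₀ (β.toFun s) (β.toFun j)
    rwa [β.gromovProduct_eq hs (Nat.cast_nonneg _), min_eq_left ((le_max_right _ _).trans hj')]

/-- Of the `4h`, half is lost in passing to the representatives given by the rays, half in the chain
that descends from far out to the heights `r` and `s`. -/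
theorem FourPoint.le_gromovProduct_ray (H : FourPoint x₀ h) (α β : GeodesicRay x₀) {r s t : ℝ}
    (hr : 0 ≤ r) (hs : 0 ≤ s) (htr : t ≤ r) (hts : t ≤ s)
    (ht : (t : EReal) ≤ boundaryProduct α.endpoint β.endpoint) :
    t - 4 * h ≤ gromovProduct x₀ (α.toFun r) (β.toFun s) := by
  refine le_of_forall_lt_imp_le_of_dense fun u hu => ?_
  have hlt : ((u + 4 * h : ℝ) : EReal) < t := EReal.coe_lt_coe_iff.2 (by linarith)
  obtain ⟨M, hM⟩ := H.exists_le_of_lt_boundaryProduct (hlt.trans_le ht)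
  obtain ⟨N, hN⟩ := exists_nat_ge (max r s)
  have hN' : max r s ≤ (max M N : ℕ) := hN.trans (Nat.cast_le.2 (le_max_right _ _))
  have hm := hM (max M N) (le_max_left _ _) (max M N) (le_max_left _ _)
  have hh := H.nonneg
  have := H.le_chain (t := u + 2 * h) (x := α.toFun r) (u := β.toFun s) ?_
    ((by linarith : u + 2 * h ≤ u + 4 * h - 2 * h).trans hm) ?_
  · linarith
  · change _ ≤ gromovProduct x₀ (α.toFun r) (α.toFun (max M N : ℕ))
    rw [α.gromovProduct_eq hr (Nat.cast_nonneg _), min_eq_left ((le_max_left _ _).trans hN')]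
    linarith
  · change _ ≤ gromovProduct x₀ (β.toFun (max M N : ℕ)) (β.toFun s)
    rw [β.gromovProduct_eq (Nat.cast_nonneg _) hs, min_eq_right ((le_max_right _ _).trans hN')]
    linarith

/-- Endpoints of rays are dense in the boundary. -/
theorem FourPoint.exists_ray_endpoint_near (H : FourPoint x₀ h) {D : ℝ}
    (hD : RaysNearEveryPoint x₀ D) (ξ : Boundary x₀) (t : ℝ) :
    ∃ γ : GeodesicRay x₀, (t : EReal) ≤ boundaryProduct γ.endpoint ξ := by
  obtain ⟨x, rfl⟩ := ξ.exists_mk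
  -- `D` pays for replacing `x_N` by a point of the ray, `h` for one four-point step.
  obtain ⟨N, hN⟩ := x.exists_le (t + h + D)
  obtain ⟨γ, s, hs, hd⟩ := hD (x.1 N)
  refine ⟨γ, ?_⟩
  obtain ⟨M, hM⟩ := exists_nat_ge s
  refine le_boundaryProduct ⟨max N M, fun i hi j hj => ?_⟩
  have hsj : t + h ≤ gromovProduct x₀ (γ.toFun s) (x.1 j) := by
    have := gromovProduct_le_add_dist x₀ (x.1 N) (γ.toFun s) (x.1 j)
    linarith [hN N le_rfl j ((le_max_left _ _).trans hj)]
  have hts := hsj.trans (gromovProduct_le_dist_left _ _ _)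
  rw [γ.dist_base hs] at hts
  have hi' : s ≤ i := hM.trans (Nat.cast_le.2 ((le_max_right _ _).trans hi))
  have := H.le (x := γ.toFun i) (by
    rwa [γ.gromovProduct_eq (Nat.cast_nonneg _) hs, min_eq_right hi']) hsj
  change t ≤ gromovProduct x₀ (γ.toFun i) (x.1 j)
  linarith

end Rays

/-! ### Transfer of products and distances through `θ`. -/

section Comparison

variable {X Y : Type*} [MetricSpace X] [MetricSpace Y] {x₀ : X} {y₀ : Y} {h : ℝ}

/-- If the boundary product of the endpoints drops by at most `k` up to height `R`, then
distances between points of the rays inside the ball of radius `R` grow by at most `2k`, up to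
an additive constant. -/
theorem dist_ray_le_dist_ray_add (HX : FourPoint x₀ h) (HY : FourPoint y₀ h)
    (α β : GeodesicRay x₀) (α' β' : GeodesicRay y₀) {R k r s : ℝ} (hk : 0 ≤ k)
    (hprod : ∀ t : ℝ, t ≤ R → (t : EReal) ≤ boundaryProduct α.endpoint β.endpoint →
      ((t - k : ℝ) : EReal) ≤ boundaryProduct α'.endpoint β'.endpoint)
    (hr : 0 ≤ r) (hs : 0 ≤ s) (hrR : r ≤ R) :
    dist (α'.toFun r) (β'.toFun s) ≤ dist (α.toFun r) (β.toFun s) + 2 * k + 12 * h := by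
  have hh := HX.nonneg
  have h1 := gromovProduct_le_dist_left x₀ (α.toFun r) (β.toFun s)
  have h2 := gromovProduct_le_dist_right x₀ (α.toFun r) (β.toFun s)
  rw [α.dist_base hr] at h1
  rw [β.dist_base hs] at h2
  -- The product drops by at most `2h + k + 4h`, and distances change by twice that. It never
  -- exceeds `r`, so a bound on `s` is not needed.
  have h3 := HY.le_gromovProduct_ray α' β' hr hs (by linarith) (by linarith)
    (hprod _ (by linarith) (HX.gromovProduct_ray_le α β hr hs))
  rw [gromovProduct, gromovProduct, α.dist_base hr, β.dist_base hs, α'.dist_base hr,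
    β'.dist_base hs] at h3
  linarith

theorem abs_sub_le_distortion {θ : Boundary x₀ → Boundary y₀} {R a b : ℝ}
    (hK : distortion θ R ≠ ⊤) {ξ₁ ξ₂ : Boundary x₀} (ha : boundaryProduct ξ₁ ξ₂ = a)
    (hb : boundaryProduct (θ ξ₁) (θ ξ₂) = b) (hab : a ≤ R ∨ b ≤ R) :
    |a - b| ≤ (distortion θ R).toReal := by
  rw [← ENNReal.ofReal_le_iff_le_toReal hK]
  have hle : Real.exp (-R) ≤ visDist ξ₁ ξ₂ ∨ Real.exp (-R) ≤ visDist (θ ξ₁) (θ ξ₂) := by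
    rw [visDist_eq_exp ha, visDist_eq_exp hb]
    exact hab.imp (fun h => Real.exp_le_exp.2 (neg_le_neg h))
      (fun h => Real.exp_le_exp.2 (neg_le_neg h))
  have : |a - b| = |Real.log (visDist (θ ξ₁) (θ ξ₂) / visDist ξ₁ ξ₂)| := by
    rw [visDist_eq_exp ha, visDist_eq_exp hb, ← Real.exp_sub, Real.log_exp]
    congr 1
    ring
  rw [this, distortion]
  exact le_iSup_of_le ξ₁ (le_iSup_of_le ξ₂ (le_iSup_of_le hle le_rfl))

/-- Up to height `R`, boundary products on the two sides differ by at most the distortion. -/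
theorem le_boundaryProduct_up_to_distortion (HX : FourPoint x₀ h) (HY : FourPoint y₀ h)
    {θ : Boundary x₀ → Boundary y₀} (hθ : Function.Injective θ) {R : ℝ}
    (hK : distortion θ R ≠ ⊤) {t : ℝ} (ht : t - (distortion θ R).toReal ≤ R) (ξ₁ ξ₂ : Boundary x₀) :
    ((t : EReal) ≤ boundaryProduct ξ₁ ξ₂ →
      ((t - (distortion θ R).toReal : ℝ) : EReal) ≤ boundaryProduct (θ ξ₁) (θ ξ₂)) ∧
    ((t : EReal) ≤ boundaryProduct (θ ξ₁) (θ ξ₂) →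
      ((t - (distortion θ R).toReal : ℝ) : EReal) ≤ boundaryProduct ξ₁ ξ₂) := by
  by_cases heq : ξ₁ = ξ₂
  · subst heq
    simp [boundaryProduct_self]
  have hbot : ∀ {a : EReal}, 0 ≤ a → a ≠ ⊥ := fun h0 => (EReal.bot_lt_zero.trans_le h0).ne'
  obtain ⟨a, ha⟩ : ∃ a : ℝ, boundaryProduct ξ₁ ξ₂ = a :=
    ⟨_, (EReal.coe_toReal (fun h => heq (HX.eq_of_boundaryProduct_eq_top h))
      (hbot (boundaryProduct_nonneg _ _))).symm⟩
  obtain ⟨b, hb⟩ : ∃ b : ℝ, boundaryProduct (θ ξ₁) (θ ξ₂) = b :=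
    ⟨_, (EReal.coe_toReal (fun h => heq (hθ (HY.eq_of_boundaryProduct_eq_top h)))
      (hbot (boundaryProduct_nonneg _ _))).symm⟩
  rw [ha, hb]
  simp only [EReal.coe_le_coe_iff]
  have h0 : 0 ≤ (distortion θ R).toReal := ENNReal.toReal_nonneg
  by_cases hab : a ≤ R ∨ b ≤ R
  · have := abs_le.1 (abs_sub_le_distortion hK ha hb hab)
    constructor <;> intro <;> linarith
  · push Not at hab
    constructor <;> intro <;> linarith

end Comparison

/-! ### Radial extensions and their coarse inverses. -/

section RadialExtensions

variable {X Y : Type*} [MetricSpace X] [MetricSpace Y] {x₀ : X} {y₀ : Y} {h D R : ℝ}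

theorem dist_le_of_dist_ray_le {x x' p p' : X} (hp : dist x p ≤ 2 * D)
    (hp' : dist x' p' ≤ 2 * D) : dist x x' ≤ dist p p' + 4 * D := by
  have := dist_triangle4 x p p' x'
  rw [dist_comm p' x'] at this
  linarith

theorem exists_isRadialExtension {θ : Boundary x₀ → Boundary y₀} (hD : RaysNearEveryPoint x₀ D)
    (hY : ∀ η : Boundary y₀, ∃ γ' : GeodesicRay y₀, γ'.endpoint = η) :
    ∃ Θ : X → Y, IsRadialExtension D θ Θ := by
  choose γ hγ using hD
  choose γ' hγ' using hY
  exact ⟨fun x => (γ' (θ (γ x).endpoint)).toFun (dist x₀ x),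
    fun x => ⟨γ x, γ' _, hγ x, hγ' _, rfl⟩⟩

theorem IsRadialExtension.dist_base {θ : Boundary x₀ → Boundary y₀} {Θ : X → Y}
    (hΘ : IsRadialExtension D θ Θ) (x : X) : dist y₀ (Θ x) = dist x₀ x := by
  obtain ⟨γ, γ', -, -, h⟩ := hΘ x
  rw [h, γ'.dist_base dist_nonneg]

theorem IsRadialExtension.abs_dist_sub_le (HX : FourPoint x₀ h) (HY : FourPoint y₀ h)
    {θ : Boundary x₀ → Boundary y₀} (hθ : Function.Injective θ) {Θ : X → Y}
    (hΘ : IsRadialExtension D θ Θ) (hK : distortion θ R ≠ ⊤) {x x' : X} (hx : dist x₀ x ≤ R) :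
    |dist (Θ x) (Θ x') - dist x x'| ≤ 2 * (distortion θ R).toReal + (12 * h + 4 * D) := by
  obtain ⟨γ, γ', hγ, he, hv⟩ := hΘ x
  obtain ⟨β, β', hβ, he', hv'⟩ := hΘ x'
  have h0 : 0 ≤ (distortion θ R).toReal := ENNReal.toReal_nonneg
  have e1 := dist_ray_le_dist_ray_add HX HY γ β γ' β' h0 (fun t ht => he ▸ he' ▸
    (le_boundaryProduct_up_to_distortion HX HY hθ hK (by linarith) _ _).1)
    (dist_nonneg (x := x₀) (y := x)) (dist_nonneg (x := x₀) (y := x')) hx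
  have e2 := dist_ray_le_dist_ray_add HY HX γ' β' γ β h0 (fun t ht => he ▸ he' ▸
    (le_boundaryProduct_up_to_distortion HX HY hθ hK (by linarith) _ _).2)
    (dist_nonneg (x := x₀) (y := x)) (dist_nonneg (x := x₀) (y := x')) hx
  rw [← hv, ← hv'] at e1 e2
  have e3 := dist_le_of_dist_ray_le hγ.dist_le hβ.dist_le
  have e4 := dist_le_of_dist_ray_le (x := γ.toFun (dist x₀ x)) (x' := β.toFun (dist x₀ x'))
    (by rw [dist_comm]; exact hγ.dist_le) (by rw [dist_comm]; exact hβ.dist_le)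
  rw [abs_le]
  constructor <;> linarith

/-- A radial extension has a coarse inverse on the ball of radius `R`: follow a ray whose
endpoint is mapped close to the endpoint of a ray passing near the given point. -/
theorem IsRadialExtension.exists_coarse_inverse (HX : FourPoint x₀ h) (HY : FourPoint y₀ h)
    (hDX : RaysNearEveryPoint x₀ D) (hDY : RaysNearEveryPoint y₀ D)
    (θ : Boundary x₀ ≃ Boundary y₀) {Θ : X → Y}
    (hΘ : IsRadialExtension D θ Θ) (hK : distortion θ R ≠ ⊤) :
    ∃ g : Y → X, (∀ y, dist x₀ (g y) = dist y₀ y) ∧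
      (∀ y y', dist y₀ y ≤ R → dist (g y) (g y') ≤
        dist y y' + 2 * (distortion θ R).toReal + (24 * h + 4 * D)) ∧
      (∀ x, dist x₀ x ≤ R →
        dist (g (Θ x)) x ≤ 2 * (distortion θ R).toReal + (18 * h + 4 * D)) ∧
      (∀ y, dist y₀ y ≤ R →
        dist (Θ (g y)) y ≤ 2 * (distortion θ R).toReal + (18 * h + 4 * D)) := by
  have h0 : 0 ≤ (distortion θ R).toReal := ENNReal.toReal_nonneg
  have hh := HX.nonneg
  have near : ∀ y : Y, ∃ (β : GeodesicRay y₀) (α : GeodesicRay x₀), β.PassesNear D y ∧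
      (R : EReal) ≤ boundaryProduct (θ α.endpoint) β.endpoint := by
    intro y
    obtain ⟨β, hβ⟩ := hDY y
    -- Applying `θ` costs the distortion, which leaves exactly height `R`.
    obtain ⟨α, hα⟩ := HX.exists_ray_endpoint_near hDX (θ.symm β.endpoint)
      (R + (distortion θ R).toReal)
    have := (le_boundaryProduct_up_to_distortion HX HY θ.injective hK (by simp) _ _).1 hα
    rw [θ.apply_symm_apply, add_sub_cancel_right] at this
    exact ⟨β, α, hβ, this⟩
  choose β α hβ hα using near
  have hα' := fun y => boundaryProduct_comm (θ (α y).endpoint) (β y).endpoint ▸ hα y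
  have tr := fun {t : ℝ} (ht : t - (distortion θ R).toReal ≤ R) (ξ₁ ξ₂ : Boundary x₀) =>
    le_boundaryProduct_up_to_distortion HX HY θ.injective hK ht ξ₁ ξ₂
  have coe_le : ∀ {s t : ℝ} {a : EReal}, s ≤ t → (t : EReal) ≤ a → (s : EReal) ≤ a :=
    fun hst hta => (EReal.coe_le_coe_iff.2 hst).trans hta
  refine ⟨fun y => (α y).toFun (dist y₀ y), fun y => (α y).dist_base dist_nonneg,
    fun y y' hy => ?_, fun x hx => ?_, fun y hy => ?_⟩
  -- Both endpoints of the `β` rays are replaced by the images of the `α` endpoints; each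
  -- replacement costs `3h`. The two estimates after this one need a single replacement.
  · have e1 := dist_ray_le_dist_ray_add HY HX (β y) (β y') (α y) (α y')
      (k := (distortion θ R).toReal + 6 * h) (by linarith) (fun t ht htp => by
        have a1 := HY.le_boundaryProduct_trans (coe_le ht (hα y)) htp
        have a2 := HY.le_boundaryProduct_trans a1 (coe_le (by linarith) (hα' y'))
        exact coe_le (by linarith) ((tr (by linarith) _ _).2 a2))
      (dist_nonneg (x := y₀) (y := y)) (dist_nonneg (x := y₀) (y := y')) hy
    have e4 := dist_le_of_dist_ray_le (x := (β y).toFun (dist y₀ y))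
      (x' := (β y').toFun (dist y₀ y'))
      (by rw [dist_comm]; exact (hβ y).dist_le) (by rw [dist_comm]; exact (hβ y').dist_le)
    linarith
  · obtain ⟨γ, γ', hγ, he, hv⟩ := hΘ x
    have e1 := dist_ray_le_dist_ray_add HY HX (β (Θ x)) γ' (α (Θ x)) γ
      (k := (distortion θ R).toReal + 3 * h) (by linarith) (fun t ht htp => by
        have a1 := HY.le_boundaryProduct_trans (coe_le ht (hα (Θ x))) htp
        rw [he] at a1
        exact coe_le (by linarith) ((tr (by linarith) _ _).2 a1))
      (dist_nonneg (x := x₀) (y := x)) (dist_nonneg (x := x₀) (y := x)) hx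
    have e2 := (hβ (Θ x)).dist_le
    have e3 := hγ.dist_le
    change dist ((α (Θ x)).toFun (dist y₀ (Θ x))) x ≤ _
    rw [hΘ.dist_base] at e2 ⊢
    rw [← hv, dist_comm _ (Θ x)] at e1
    have e4 := dist_triangle ((α (Θ x)).toFun (dist x₀ x)) (γ.toFun (dist x₀ x)) x
    rw [dist_comm (γ.toFun _) x] at e4
    linarith
  · set x := (α y).toFun (dist y₀ y) with hxdef
    have hx : dist x₀ x = dist y₀ y := (α y).dist_base dist_nonneg
    obtain ⟨γ, γ', hγ, he, hv⟩ := hΘ x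
    have e1 := dist_ray_le_dist_ray_add HX HY γ (α y) γ' (β y)
      (k := (distortion θ R).toReal + 3 * h) (by linarith) (fun t ht htp => by
        have a1 := (tr (by linarith) _ _).1 htp
        rw [← he] at a1
        exact coe_le (by linarith)
          (HY.le_boundaryProduct_trans a1 (coe_le (by linarith) (hα y))))
      (dist_nonneg (x := y₀) (y := y)) (dist_nonneg (x := y₀) (y := y)) hy
    have e2 := (hβ y).dist_le
    have e3 := hγ.dist_le
    rw [hx] at e3 hv
    rw [← hv, ← hxdef, dist_comm _ x] at e1
    have e4 := dist_triangle (Θ x) ((β y).toFun (dist y₀ y)) y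
    rw [dist_comm ((β y).toFun _) y] at e4
    change dist (Θ x) y ≤ _
    linarith

end RadialExtensions

end RadialQI

/-! ### The theorem with explicit constants. -/

theorem mainTheorem4 :
    ∃ A : ℝ, 0 < A ∧
      ∀ (X Y : Type*) [MetricSpace X] [MetricSpace Y] (x₀ : X) (y₀ : Y) (δ D : ℝ),
        0 ≤ δ →
        RadialQI.IsGeodesicSpace X → RadialQI.IsGeodesicSpace Y →
        RadialQI.IsDeltaHyperbolic X δ → RadialQI.IsDeltaHyperbolic Y δ →
        RadialQI.RaysNearEveryPoint x₀ D → RadialQI.RaysNearEveryPoint y₀ D →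
        ∀ θ : RadialQI.Boundary x₀ ≃ₜ RadialQI.Boundary y₀,
          ((∀ η : RadialQI.Boundary y₀, ∃ γ' : RadialQI.GeodesicRay y₀, γ'.endpoint = η) →
            ∃ Θ : X → Y, RadialQI.IsRadialExtension D θ Θ) ∧
          ∀ Θ : X → Y, RadialQI.IsRadialExtension D θ Θ →
            ∀ R : ℝ, 0 < R → RadialQI.distortion θ R ≠ ⊤ →
              ∃ hΘ : Set.MapsTo Θ (Metric.closedBall x₀ R) (Metric.closedBall y₀ R),
                RadialQI.IsQuasiIsometry
                  (1 + 2 * (RadialQI.distortion θ R).toReal / (A * (D + δ)))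
                  (2 * (RadialQI.distortion θ R).toReal + A * (D + δ))
                  (hΘ.restrict Θ (Metric.closedBall x₀ R) (Metric.closedBall y₀ R)) ∧
                RadialQI.IsQuasiIsometricEmbedding
                  (1 + 2 * (RadialQI.distortion θ R).toReal / (A * (D + δ)))
                  (2 * (RadialQI.distortion θ R).toReal + A * (D + δ))
                  (hΘ.restrict Θ (Metric.closedBall x₀ R) (Metric.closedBall y₀ R)) := by
  -- The largest error is `24h + 4D` with `h = 3δ`, that is `72δ + 4D`.
  refine ⟨100, by norm_num, ?_⟩
  intro X Y _ _ x₀ y₀ δ D hδ gX gY hypX hypY rX rY θ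
  refine ⟨RadialQI.exists_isRadialExtension rX, fun Θ hΘ R _ hK => ?_⟩
  have HX := hypX.fourPoint hδ gX x₀
  have HY := hypY.fourPoint hδ gY y₀
  -- The strict inequality in `PassesNear` forces `D > 0`, so the denominator `c` is positive.
  have hD : 0 < D := by
    obtain ⟨γ, t, -, hd⟩ := rX x₀
    exact dist_nonneg.trans_lt hd
  have hK0 : 0 ≤ (RadialQI.distortion θ R).toReal := ENNReal.toReal_nonneg
  obtain ⟨g, hg, hgd, hgf, hfg⟩ :=
    hΘ.exists_coarse_inverse HX HY rX rY θ.toEquiv hK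
  have hfd := fun {x x' : X} => hΘ.abs_dist_sub_le HX HY θ.injective hK (x := x) (x' := x')
  simp only [Homeomorph.coe_toEquiv] at hgd hgf hfg
  set K := (RadialQI.distortion θ R).toReal
  have hq : 0 ≤ 2 * K / (100 * (D + δ)) := by positivity
  have hmul : ∀ d : ℝ, 0 ≤ d → d ≤ (1 + 2 * K / (100 * (D + δ))) * d := fun d hd =>
    le_mul_of_one_le_left hd (by linarith)
  have hmaps : Set.MapsTo Θ (Metric.closedBall x₀ R) (Metric.closedBall y₀ R) := fun x hx => by
    rw [Metric.mem_closedBall'] at hx ⊢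
    rwa [hΘ.dist_base]
  have hgmaps : Set.MapsTo g (Metric.closedBall y₀ R) (Metric.closedBall x₀ R) := fun y hy => by
    rw [Metric.mem_closedBall'] at hy ⊢
    rwa [hg]
  have hup : ∀ x x' : Metric.closedBall x₀ R, dist (Θ x) (Θ x') ≤
      (1 + 2 * K / (100 * (D + δ))) * dist (x : X) x' + (2 * K + 100 * (D + δ)) := by
    intro x x'
    have h1 := (abs_le.1 (hfd (x' := x') (Metric.mem_closedBall'.1 x.2))).2
    have h2 := hmul (dist (x : X) x') dist_nonneg
    linarith
  refine ⟨hmaps, ⟨hgmaps.restrict g _ _, hup, fun y y' => ?_, fun x => ?_, fun y => ?_⟩,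
    fun x x' => ⟨?_, hup x x'⟩⟩
  · change dist (g y) (g y') ≤ _ * dist (y : Y) y' + _
    have h1 := hgd y y' (Metric.mem_closedBall'.1 y.2)
    have h2 := hmul (dist (y : Y) y') dist_nonneg
    linarith
  · change dist (g (Θ x)) x ≤ _
    linarith [hgf x (Metric.mem_closedBall'.1 x.2)]
  · change dist (Θ (g y)) y ≤ _
    linarith [hfg y (Metric.mem_closedBall'.1 y.2)]
  · change 1 / _ * (dist (x : X) x' - _) ≤ dist (Θ x) (Θ x')
    have h1 := (abs_le.1 (hfd (x' := x') (Metric.mem_closedBall'.1 x.2))).1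
    have h2 := hmul (dist (Θ x) (Θ x')) dist_nonneg
    -- With `C` the additive constant, `dist x x' - C` is already at most `dist (Θ x) (Θ x')`;
    -- multiplying the latter by a factor at least `1` only helps.
    rw [one_div_mul_eq_div, div_le_iff₀' (by linarith)]
    linarith
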